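/- Let $H$ be a separable complex Hilbert space with inner product $(\cdot,\cdot)$, linear in the first variable. Let $(p_n)_{n\ge 1}$ be an increasing sequence of orthogonal projections on $H$ with $\bigvee_n p_n=I$, let $H_n=p_nH$ and $\mathcal X=\bigcup_n H_n$. Let $\mathcal C_2(H_n)$ be the Hilbert–Schmidt operators on $H_n$, regarded as the Hilbert–Schmidt operators $a$ on $H$ with $p_nap_n=a$, and let $\mathcal A=\bigcup_n\mathcal C_2(H_n)$, a $*$-algebra. Let $\Phi$ be a linear map from $\mathcal A$ to the space $\mathcal L(\mathcal X)$ of all linear maps $\mathcal X\to\mathcal X$ such that (a) $\Phi$ is completely positive: $\sum_{k,l=1}^n(\Phi(a_k^*a_l)\xi_l,\xi_k)\ge 0$ for all $n\in\mathbb N$, $a_1,\dots,a_n\in\mathcal A$ and $\xi_1,\dots,\xi_n\in\mathcal X$; (b) $\Phi(p_nap_m)=p_n\Phi(a)p_m$ for all $n,m\in\mathbb N$ and $a\in\mathcal A$; (c) for every $n$ the restriction of $\Phi$ to $\mathcal C_2(H_n)$ is bounded with respect to the operator norm: there is a constant $C_n$ with $\|\Phi(a)\xi\|\le C_n\|a\|_{\mathrm{op}}\|\xi\|$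 for all $a\in\mathcal C_2(H_n)$ and $\xi\in\mathcal X$. Then: (i) There is a sequence $(V_i)_{i=1}^\infty$ of closable linear maps from $\mathcal X$ into $H$ such that $$(\Phi(a)\xi,\eta)=\sum_{i=1}^\infty(aV_i\xi,V_i\eta)\qquad\text{for all } a\in\mathcal A,\ \xi,\eta\in\mathcal X,$$ the series being absolutely convergent. (ii) If $\mathcal D\subseteq\mathcal B(H)$ is a unital C*-subalgebra which contains all the $p_n$, and $\Phi$ is $\mathcal D$-bimodular, that is, $\Phi(ras)\xi=r\Phi(a)s\xi$ for all $r,s\in\mathcal D$, $a\in\mathcal A$ and $\xi\in\mathcal X$ for which $ras\in\mathcal A$ and $s\xi\in\mathcal X$, then there is such a sequence $(V_i)$ as in (i) for which, in addition, the closure of every $V_i$ is affiliated with the commutant $\mathcal D'$. Here a closed densely defined operator $T$ on $H$ is affiliated with a von Neumann algebra $\mathcal M$ if $uT=Tu$, with equality of domains, for every unitary $u\in\mathcal M'$. -/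

import Mathlib

open scoped ComplexOrder

namespace UnboundedStinespring

variable {H : Type*} [NormedAddCommGroup H] [InnerProductSpace ℂ H] [CompleteSpace H]

/-! ### Hilbert-Schmidt operators -/

/-- A bounded operator `a` is Hilbert-Schmidt if `∑ ‖a eᵢ‖² < ∞` for some orthonormal basis
`(eᵢ)` of `H` (equivalently for every one, see `IsHilbertSchmidt.summable`). -/
def IsHilbertSchmidt (a : H →L[ℂ] H) : Prop :=
  ∃ (s : Set H) (b : HilbertBasis s ℂ H), Summable fun i => ‖a (b i)‖ ^ 2

theorem hasSum_norm_inner_sq {ι : Type*} (b : HilbertBasis ι ℂ H) (x : H) :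
    HasSum (fun i => ‖(inner ℂ (b i) x : ℂ)‖ ^ 2) (‖x‖ ^ 2) := by
  have h := (b.hasSum_inner_mul_inner x x).mapL Complex.reCLM
  convert h using 1
  · funext i
    have h1 : (inner ℂ x (b i) : ℂ) = (starRingEnd ℂ) (inner ℂ (b i) x) :=
      (inner_conj_symm _ _).symm
    rw [h1, ← Complex.normSq_eq_conj_mul_self]
    simp [Complex.normSq_eq_norm_sq]
    norm_cast
  · simp only [Complex.reCLM_apply]
    rw [inner_self_eq_norm_sq_to_K]
    norm_cast

theorem tsum_enorm_inner_sq {ι : Type*} (b : HilbertBasis ι ℂ H) (x : H) :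
    ∑' i, ENNReal.ofReal (‖(inner ℂ (b i) x : ℂ)‖ ^ 2) = ENNReal.ofReal (‖x‖ ^ 2) := by
  rw [← (hasSum_norm_inner_sq b x).tsum_eq]
  exact (ENNReal.ofReal_tsum_of_nonneg (fun _ => by positivity)
    (hasSum_norm_inner_sq b x).summable).symm

theorem tsum_hilbertSchmidt_adjoint {ι κ : Type*} (b : HilbertBasis ι ℂ H)
    (c : HilbertBasis κ ℂ H) (a : H →L[ℂ] H) :
    ∑' i, ENNReal.ofReal (‖a (b i)‖ ^ 2) = ∑' j, ENNReal.ofReal (‖(star a) (c j)‖ ^ 2) := by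
  simp_rw [← tsum_enorm_inner_sq c (a _), ← tsum_enorm_inner_sq b (star a _)]
  rw [ENNReal.tsum_comm]
  congr 1; funext j; congr 1; funext i
  rw [ContinuousLinearMap.star_eq_adjoint, ContinuousLinearMap.adjoint_inner_right,
    norm_inner_symm]

theorem summable_iff_tsum_ne_top {ι : Type*} (f : ι → ℝ) (hf : ∀ i, 0 ≤ f i) :
    Summable f ↔ ∑' i, ENNReal.ofReal (f i) ≠ ⊤ := by
  refine ⟨fun h => h.tsum_ofReal_ne_top, fun h => ?_⟩
  have := ENNReal.summable_toReal h
  simpa [ENNReal.toReal_ofReal (hf _)] using this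

theorem IsHilbertSchmidt.star_summable {a : H →L[ℂ] H} (h : IsHilbertSchmidt a) {ι : Type*}
    (b : HilbertBasis ι ℂ H) : Summable fun i => ‖(star a) (b i)‖ ^ 2 := by
  obtain ⟨s, c, hc⟩ := h
  rw [summable_iff_tsum_ne_top _ (fun _ => by positivity)] at hc ⊢
  rwa [← tsum_hilbertSchmidt_adjoint c b a]

theorem IsHilbertSchmidt.star {a : H →L[ℂ] H} (h : IsHilbertSchmidt a) :
    IsHilbertSchmidt (star a) := by
  obtain ⟨s, c, hc⟩ := id h
  exact ⟨s, c, h.star_summable c⟩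

/-- The Hilbert-Schmidt condition does not depend on the orthonormal basis. -/
theorem IsHilbertSchmidt.summable {a : H →L[ℂ] H} (h : IsHilbertSchmidt a) {ι : Type*}
    (b : HilbertBasis ι ℂ H) : Summable fun i => ‖a (b i)‖ ^ 2 := by
  simpa using h.star.star_summable b

theorem IsHilbertSchmidt.zero : IsHilbertSchmidt (0 : H →L[ℂ] H) := by
  obtain ⟨s, b, -⟩ := exists_hilbertBasis ℂ H
  exact ⟨s, b, by simpa using summable_zero⟩

theorem IsHilbertSchmidt.smul {a : H →L[ℂ] H} (h : IsHilbertSchmidt a) (c : ℂ) :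
    IsHilbertSchmidt (c • a) := by
  obtain ⟨s, b, hb⟩ := h
  refine ⟨s, b, ?_⟩
  simpa [norm_smul, mul_pow] using hb.mul_left (‖c‖ ^ 2)

theorem IsHilbertSchmidt.add {a a' : H →L[ℂ] H} (h : IsHilbertSchmidt a)
    (h' : IsHilbertSchmidt a') : IsHilbertSchmidt (a + a') := by
  obtain ⟨s, b, hb⟩ := h
  refine ⟨s, b, Summable.of_nonneg_of_le (fun _ => by positivity) (fun i => ?_)
    ((hb.add (h'.summable b)).mul_left 2)⟩
  have h1 := norm_add_le (a (b i)) (a' (b i))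
  have h2 : ‖(a + a') (b i)‖ ^ 2 ≤ (‖a (b i)‖ + ‖a' (b i)‖) ^ 2 := by
    gcongr
    simpa using h1
  nlinarith [sq_nonneg (‖a (b i)‖ - ‖a' (b i)‖)]

theorem IsHilbertSchmidt.mul_left {a : H →L[ℂ] H} (h : IsHilbertSchmidt a) (r : H →L[ℂ] H) :
    IsHilbertSchmidt (r * a) := by
  obtain ⟨s, b, hb⟩ := h
  refine ⟨s, b, Summable.of_nonneg_of_le (fun _ => by positivity) (fun i => ?_)
    (hb.mul_left (‖r‖ ^ 2))⟩
  rw [← mul_pow]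
  gcongr
  exact r.le_opNorm _

theorem IsHilbertSchmidt.mul_right {a : H →L[ℂ] H} (h : IsHilbertSchmidt a) (r : H →L[ℂ] H) :
    IsHilbertSchmidt (a * r) := by
  simpa using (h.star.mul_left (Star.star r)).star

/-! ### The exhausting sequence of projections and the local spaces -/

variable (H) in
/-- An increasing sequence `(pₙ)` of orthogonal projections on `H` (for the usual order of
self-adjoint operators) with `⋁ pₙ = I`, that is, the ranges `Hₙ = pₙ H` span a dense subspace. -/
structure ProjectionSequence where
  p : ℕ → H →L[ℂ] H
  isStarProjection : ∀ n, IsStarProjection (p n)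
  monotone : Monotone p
  dense : (⨆ n, (p n).range).topologicalClosure = ⊤

namespace ProjectionSequence

variable (P : ProjectionSequence H)

theorem mul_of_le {m n : ℕ} (h : m ≤ n) : P.p n * P.p m = P.p m :=
  ((P.isStarProjection m).le_iff_mul_eq_right (P.isStarProjection n)).mp (P.monotone h)

theorem mul_of_le' {m n : ℕ} (h : m ≤ n) : P.p m * P.p n = P.p m :=
  ((P.isStarProjection m).le_iff_mul_eq_left (P.isStarProjection n)).mp (P.monotone h)

theorem range_mono : Monotone fun n => (P.p n).range := by
  rintro m n h _ ⟨x, rfl⟩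
  exact ⟨P.p m x, congrArg (fun T : H →L[ℂ] H => T x) (P.mul_of_le h)⟩

/-- The subspace `X = ⋃ₙ Hₙ` of `H`. -/
def X : Submodule ℂ H := ⨆ n, (P.p n).range

theorem mem_X_iff_exists_range {x : H} : x ∈ P.X ↔ ∃ n, x ∈ (P.p n).range :=
  Submodule.mem_iSup_of_directed _ P.range_mono.directed_le

theorem mem_range_iff {n : ℕ} {x : H} : x ∈ (P.p n).range ↔ P.p n x = x := by
  refine ⟨?_, fun h => ⟨x, h⟩⟩
  rintro ⟨y, rfl⟩
  exact congrArg (fun T : H →L[ℂ] H => T y) (P.isStarProjection n).isIdempotentElem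

/-- `a` belongs to `C₂(Hₙ)`, the Hilbert-Schmidt operators on `Hₙ`, regarded as operators on `H`
which vanish on the orthogonal complement of `Hₙ`. -/
def MemC2 (n : ℕ) (a : H →L[ℂ] H) : Prop :=
  IsHilbertSchmidt a ∧ P.p n * a * P.p n = a

variable {P} in
theorem MemC2.left {n : ℕ} {a : H →L[ℂ] H} (h : P.MemC2 n a) {m : ℕ} (hm : n ≤ m) :
    P.p m * a = a := by
  rw [← h.2, ← mul_assoc, ← mul_assoc, P.mul_of_le hm]

variable {P} in
theorem MemC2.right {n : ℕ} {a : H →L[ℂ] H} (h : P.MemC2 n a) {m : ℕ} (hm : n ≤ m) :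
    a * P.p m = a := by
  rw [← h.2, mul_assoc, P.mul_of_le' hm]

variable {P} in
theorem MemC2.mono {n m : ℕ} {a : H →L[ℂ] H} (h : P.MemC2 n a) (hm : n ≤ m) : P.MemC2 m a :=
  ⟨h.1, by rw [h.left hm, h.right hm]⟩

/-- The `*`-algebra `A = ⋃ₙ C₂(Hₙ)`. -/
def A : NonUnitalStarSubalgebra ℂ (H →L[ℂ] H) where
  carrier := {a | ∃ n, P.MemC2 n a}
  zero_mem' := ⟨0, IsHilbertSchmidt.zero, by simp⟩
  add_mem' := by
    rintro a b ⟨n, ha⟩ ⟨m, hb⟩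
    have ha' := ha.mono (le_max_left n m)
    have hb' := hb.mono (le_max_right n m)
    exact ⟨max n m, ha'.1.add hb'.1, by rw [mul_add, add_mul, ha'.2, hb'.2]⟩
  smul_mem' := by
    rintro c a ⟨n, ha⟩
    exact ⟨n, ha.1.smul c, by rw [mul_smul_comm, smul_mul_assoc, ha.2]⟩
  mul_mem' := by
    rintro a b ⟨n, ha⟩ ⟨m, hb⟩
    exact ⟨max n m, hb.1.mul_left a, by
      rw [← mul_assoc, ha.left (le_max_left n m), mul_assoc, hb.right (le_max_right n m)]⟩
  star_mem' := by
    rintro a ⟨n, ha⟩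
    refine ⟨n, ha.1.star, ?_⟩
    have h := congrArg star ha.2
    simpa [mul_assoc, (P.isStarProjection n).isSelfAdjoint.star_eq] using h

theorem mem_A_iff {a : H →L[ℂ] H} : a ∈ P.A ↔ ∃ n, P.MemC2 n a := Iff.rfl

theorem p_apply_mem_X (n : ℕ) (x : H) : P.p n x ∈ P.X :=
  P.mem_X_iff_exists_range.mpr ⟨n, x, rfl⟩

theorem p_mul_mul_p_mem_A {a : H →L[ℂ] H} (ha : a ∈ P.A) (n m : ℕ) :
    P.p n * a * P.p m ∈ P.A := by
  obtain ⟨k, hk⟩ := ha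
  refine ⟨max n m, (hk.1.mul_left _).mul_right _, ?_⟩
  rw [← mul_assoc, ← mul_assoc, P.mul_of_le (le_max_left n m), mul_assoc,
    P.mul_of_le' (le_max_right n m)]

/-- `pₙ` as a linear map on `X`. -/
noncomputable def pX (n : ℕ) : Module.End ℂ P.X :=
  ((P.p n : H →ₗ[ℂ] H).comp P.X.subtype).codRestrict P.X fun x => P.p_apply_mem_X n x

/-- `pₙ a pₘ` as an element of `A`, for `a ∈ A`. -/
def cut (n m : ℕ) (a : P.A) : P.A :=
  ⟨P.p n * (a : H →L[ℂ] H) * P.p m, P.p_mul_mul_p_mem_A a.2 n m⟩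

/-! ### Properties of linear maps `Φ : A → L(X)`

The inner product of `x` and `y`, linear in `x`, is Mathlib's `inner ℂ y x`. -/

/-- Complete positivity: `∑_{k,l} (Φ(aₖ* aₗ) ξₗ, ξₖ) ≥ 0`. -/
def IsCompletelyPositive (Φ : P.A →ₗ[ℂ] Module.End ℂ P.X) : Prop :=
  ∀ (n : ℕ) (a : Fin n → P.A) (ξ : Fin n → P.X),
    0 ≤ ∑ k, ∑ l, inner ℂ (ξ k : H) (Φ (star (a k) * a l) (ξ l) : H)

/-- Compatibility with the projections: `Φ(pₙ a pₘ) = pₙ Φ(a) pₘ`. -/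
def IsCompatible (Φ : P.A →ₗ[ℂ] Module.End ℂ P.X) : Prop :=
  ∀ (n m : ℕ) (a : P.A), Φ (P.cut n m a) = P.pX n * Φ a * P.pX m

/-- For each `n`, the restriction of `Φ` to `C₂(Hₙ)` is bounded for the operator norms. -/
def IsLocallyBounded (Φ : P.A →ₗ[ℂ] Module.End ℂ P.X) : Prop :=
  ∀ n, ∃ C : ℝ, ∀ a : P.A, P.MemC2 n a → ∀ ξ : P.X,
    ‖(Φ a ξ : H)‖ ≤ C * ‖(a : H →L[ℂ] H)‖ * ‖(ξ : H)‖

/-- `D`-bimodularity: `Φ(r a s) = r Φ(a) s` for `r, s ∈ D` and `a ∈ A`. Elements of `D` need not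
map `X` into `X` or multiply `A` into `A`; the identity is required, and evaluated at `ξ ∈ X`,
exactly when it makes sense, that is, when `r a s ∈ A` and `s ξ ∈ X`. If `D X ⊆ X`, this is always
the case. -/
def IsBimodular (D : StarSubalgebra ℂ (H →L[ℂ] H)) (Φ : P.A →ₗ[ℂ] Module.End ℂ P.X) : Prop :=
  ∀ r ∈ D, ∀ s ∈ D, ∀ a b : P.A, (b : H →L[ℂ] H) = r * a * s →
    ∀ ξ η : P.X, (η : H) = s ξ → (Φ b ξ : H) = r (Φ a η)

end ProjectionSequence

/-! ### Affiliated operators -/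

/-- The commutant `D'` of a unital `*`-algebra `D` of operators, as a von Neumann algebra. -/
noncomputable def commutant (D : StarSubalgebra ℂ (H →L[ℂ] H)) : VonNeumannAlgebra H where
  toStarSubalgebra := StarSubalgebra.centralizer ℂ (D : Set (H →L[ℂ] H))
  centralizer_centralizer' := by
    have h : (star (D : Set (H →L[ℂ] H))) = D := by
      ext x; simp
    simp [StarSubalgebra.coe_centralizer, h]

theorem mem_commutant_iff {D : StarSubalgebra ℂ (H →L[ℂ] H)} {z : H →L[ℂ] H} :
    z ∈ commutant D ↔ ∀ g ∈ D, g * z = z * g := by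
  change z ∈ StarSubalgebra.centralizer ℂ (D : Set (H →L[ℂ] H)) ↔ _
  rw [StarSubalgebra.mem_centralizer_iff]
  exact ⟨fun h g hg => (h g hg).1, fun h g hg => ⟨h g hg, h _ (star_mem hg)⟩⟩

/-- A closed densely defined operator `T` on `H` is affiliated with the von Neumann algebra `M`
if `u T = T u` (with equality of domains) for every unitary `u` in `M'`. As the unitaries of `M'`
form a group, this amounts to `u (dom T) ⊆ dom T` and `T u x = u T x` for `x ∈ dom T`. -/
def IsAffiliated (T : H →ₗ.[ℂ] H) (M : VonNeumannAlgebra H) : Prop :=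
  T.IsClosed ∧ Dense (T.domain : Set H) ∧
    ∀ u ∈ M.commutant, u ∈ unitary (H →L[ℂ] H) →
      ∀ x : T.domain, ∃ y : T.domain, (y : H) = u x ∧ T y = u (T x)

/-- A linear map from a subspace `Y` of `H` to `H`, as an operator on `H` with domain `Y`. -/
def toPMap {Y : Submodule ℂ H} (V : Y →ₗ[ℂ] H) : H →ₗ.[ℂ] H := ⟨Y, V⟩

end UnboundedStinespring

namespace UnboundedStinespring

open InnerProductSpace Filter Topology

variable {H : Type*} [NormedAddCommGroup H] [InnerProductSpace ℂ H] [CompleteSpace H]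

/-! ### Subspaces invariant under the bicommutant -/

/-! Write x⊗y for `rankOneA x y` and take ⟨·,·⟩ linear in the second variable. For a unit vector e,
x⊗y = (e⊗x)*(e⊗y), so complete positivity makes ⟨η, Φ(x⊗y)ξ⟩ a positive definite kernel on pairs
(x,η), (y,ξ). Its feature map k (`exists_feature_map`) is conjugate linear in the first entry and
linear in the second. The coordinates of k in a Hilbert basis (f_j) are represented by Riesz as ⟨x,
V_j ξ⟩ = ⟨f_j, k(x,ξ)⟩, and Parseval gives the formula on rank one operators
(`exists_kraus_family`).

Testing Φ on compressed finite rank projections, all of operator norm at most 1, bounds ∑‖V_j ξ‖²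
(`RepresentsRankOne.sum_norm_sq_le`). Both sides of the formula are then continuous on C₂(Hₙ) in
operator norm, where finite rank operators are dense (`RepresentsRankOne.hasSum`). Separability
leaves countably many nonzero V_j.

If Φ(ad) = Φ(a)d, then k(d*x, ξ) = k(x, dξ), hence V_j d = d V_j where defined. With d = pₙ and
local boundedness this yields closability. With d a compression pₙrpₙ, r ∈ D, a limit makes the
closed graph of V_j invariant under D; it is then invariant under the bicommutant, which is
affiliation (`isAffiliated_closure`). -/

/-- The operator `d ⊕ d` on the Hilbert space `H ⊕ H`. -/
noncomputable def diag (d : H →L[ℂ] H) : WithLp 2 (H × H) →L[ℂ] WithLp 2 (H × H) :=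
  ((WithLp.prodContinuousLinearEquiv 2 ℂ H H).symm : H × H →L[ℂ] WithLp 2 (H × H)) ∘L
    (d.prodMap d) ∘L ((WithLp.prodContinuousLinearEquiv 2 ℂ H H) : WithLp 2 (H × H) →L[ℂ] H × H)

theorem diag_apply (d : H →L[ℂ] H) (z : WithLp 2 (H × H)) :
    diag d z = WithLp.toLp 2 (d z.fst, d z.snd) := rfl

theorem inner_diag_left (d : H →L[ℂ] H) (z w : WithLp 2 (H × H)) :
    inner ℂ (diag d z) w = inner ℂ z (diag (star d) w) := by
  simp [WithLp.prod_inner_apply, diag_apply, ContinuousLinearMap.star_eq_adjoint,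
    ContinuousLinearMap.adjoint_inner_right]

/-- The projection onto an invariant subspace of a `*`-algebra commutes with the algebra. -/
theorem starProjection_diag {D : StarSubalgebra ℂ (H →L[ℂ] H)}
    (G : Submodule ℂ (WithLp 2 (H × H))) [G.HasOrthogonalProjection]
    (hG : ∀ d ∈ D, ∀ z ∈ G, diag d z ∈ G) {d : H →L[ℂ] H} (hd : d ∈ D) (z : WithLp 2 (H × H)) :
    G.starProjection (diag d z) = diag d (G.starProjection z) := by
  -- The residual d(z − Gz) stays orthogonal to `G` because `star d` also preserves `G`.
  refine Submodule.eq_starProjection_of_mem_of_inner_eq_zero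
    (hG d hd _ (G.starProjection_apply_mem z)) fun w hw => ?_
  rw [← map_sub, inner_diag_left]
  exact G.starProjection_inner_eq_zero z _ (hG _ (star_mem hd) w hw)

/-- A closed subspace of `H ⊕ H` invariant under a unital `*`-algebra is invariant under its
bicommutant. -/
theorem diag_mem_of_mem_bicommutant {D : StarSubalgebra ℂ (H →L[ℂ] H)}
    (G : Submodule ℂ (WithLp 2 (H × H))) (hcl : IsClosed (G : Set (WithLp 2 (H × H))))
    (hG : ∀ d ∈ D, ∀ z ∈ G, diag d z ∈ G) {u : H →L[ℂ] H} (hu : u ∈ (commutant D).commutant)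
    {z : WithLp 2 (H × H)} (hz : z ∈ G) : diag u z ∈ G := by
  have : CompleteSpace G := hcl.completeSpace_coe
  let e : WithLp 2 (H × H) →L[ℂ] H × H := (WithLp.prodContinuousLinearEquiv 2 ℂ H H)
  let e' : H × H →L[ℂ] WithLp 2 (H × H) := (WithLp.prodContinuousLinearEquiv 2 ℂ H H).symm
  let Q := e ∘L G.starProjection ∘L e'
  have hQ : ∀ d ∈ D, ∀ x : H × H, Q (d x.1, d x.2) = (d (Q x).1, d (Q x).2) := fun d hd x =>
    congrArg e (starProjection_diag G hG hd (e' x))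
  -- Each of the four matrix entries π Q i of the projection commutes with `D`, so lies in `D'` and
  -- commutes with `u`.
  have key : ∀ (i : H →L[ℂ] H × H) (π : H × H →L[ℂ] H), (∀ d ∈ D, ∀ x, i (d x) =
      (d (i x).1, d (i x).2)) → (∀ d ∈ D, ∀ x : H × H, π (d x.1, d x.2) = d (π x)) →
      ∀ x, π (Q (i (u x))) = u (π (Q (i x))) := by
    intro i π hi hπ x
    have hmem : π ∘L Q ∘L i ∈ commutant D := by
      rw [mem_commutant_iff]
      intro g hg
      ext y
      change g (π (Q (i y))) = π (Q (i (g y)))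
      rw [hi g hg, hQ g hg, hπ g hg]
    have := (VonNeumannAlgebra.mem_commutant_iff.mp hu) _ hmem
    exact congrArg (fun T : H →L[ℂ] H => T x) this
  have hdec : ∀ x : H × H, Q x = Q (ContinuousLinearMap.inl ℂ H H x.1) +
      Q (ContinuousLinearMap.inr ℂ H H x.2) := fun x => by
    rw [← map_add]; simp
  have hz' : Q (z.fst, z.snd) = (z.fst, z.snd) :=
    congrArg e (G.starProjection_eq_self_iff.mpr hz)
  have hu' : Q (u z.fst, u z.snd) = (u (Q (z.fst, z.snd)).1, u (Q (z.fst, z.snd)).2) := by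
    have hl := fun π hπ => key (ContinuousLinearMap.inl ℂ H H) π (by simp) hπ
    have hr := fun π hπ => key (ContinuousLinearMap.inr ℂ H H) π (by simp) hπ
    have h1 := fun x => hl (ContinuousLinearMap.fst ℂ H H) (by simp) x
    have h2 := fun x => hl (ContinuousLinearMap.snd ℂ H H) (by simp) x
    have h3 := fun x => hr (ContinuousLinearMap.fst ℂ H H) (by simp) x
    have h4 := fun x => hr (ContinuousLinearMap.snd ℂ H H) (by simp) x
    simp only [ContinuousLinearMap.coe_fst', ContinuousLinearMap.coe_snd'] at h1 h2 h3 h4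
    rw [hdec, hdec (z.fst, z.snd)]
    ext
    · simp only [Prod.fst_add, map_add, h1, h3]
    · simp only [Prod.snd_add, map_add, h2, h4]
  rw [hz'] at hu'
  refine G.starProjection_eq_self_iff.mp ?_
  exact congrArg e' hu'

/-! ### Convergence of the projections -/

namespace ProjectionSequence

variable (P : ProjectionSequence H)

theorem exists_forall_p_apply_eq {x : H} (hx : x ∈ P.X) : ∃ n, ∀ m, n ≤ m → P.p m x = x := by
  obtain ⟨n, hn⟩ := P.mem_X_iff_exists_range.mp hx
  exact ⟨n, fun m hm => P.mem_range_iff.mp (P.range_mono hm hn)⟩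

theorem norm_p_le (n : ℕ) : ‖P.p n‖ ≤ 1 := (P.isStarProjection n).norm_le

theorem norm_p_apply_le (n : ℕ) (x : H) : ‖P.p n x‖ ≤ ‖x‖ :=
  (P.p n).le_of_opNorm_le_of_le (P.norm_p_le n) le_rfl |>.trans_eq (one_mul _)

theorem inner_p_left (n : ℕ) (x y : H) : inner ℂ (P.p n x) y = inner ℂ x (P.p n y) := by
  rw [← ContinuousLinearMap.adjoint_inner_right, ← ContinuousLinearMap.star_eq_adjoint,
    (P.isStarProjection n).isSelfAdjoint.star_eq]

theorem dense_X : Dense (P.X : Set H) := by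
  rw [Submodule.dense_iff_topologicalClosure_eq_top]
  exact P.dense

theorem tendsto_p_apply (x : H) : Tendsto (fun n => P.p n x) atTop (𝓝 x) := by
  rw [Metric.tendsto_atTop]
  intro ε hε
  obtain ⟨y, hy, hxy⟩ := P.dense_X.exists_dist_lt x (half_pos hε)
  obtain ⟨N, hN⟩ := P.exists_forall_p_apply_eq hy
  refine ⟨N, fun n hn => ?_⟩
  have h1 : dist (P.p n x) (P.p n y) ≤ dist x y := by
    rw [dist_eq_norm, dist_eq_norm, ← map_sub]
    exact P.norm_p_apply_le n _
  rw [hN n hn] at h1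
  have := dist_triangle (P.p n x) y x
  rw [dist_comm y x] at this
  linarith

@[simp]
theorem coe_pX (n : ℕ) (ξ : P.X) : ((P.pX n ξ : P.X) : H) = P.p n ξ := rfl

/-- A linear map `X → H` commuting with the `pₙ` and bounded on every `Hₙ` is closable. -/
theorem isClosable_toPMap (V : P.X →ₗ[ℂ] H) (hcomm : ∀ n ξ, V (P.pX n ξ) = P.p n (V ξ))
    (hbd : ∀ n, ∃ C : ℝ, ∀ ξ, ‖V (P.pX n ξ)‖ ≤ C * ‖(ξ : H)‖) : (toPMap V).IsClosable := by
  -- This estimate is a closed condition on pairs, so it passes from the graph to its closure; over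
  -- 0 it forces every pₙ to kill the second entry.
  have hle : ∀ n, ∃ C : ℝ, ∀ z ∈ (toPMap V).graph.topologicalClosure, ‖P.p n z.2‖ ≤ C * ‖z.1‖ := by
    intro n
    obtain ⟨C, hC⟩ := hbd n
    refine ⟨C, fun z hz => ?_⟩
    have hcl : IsClosed {z : H × H | ‖P.p n z.2‖ ≤ C * ‖z.1‖} :=
      isClosed_le (by fun_prop) (by fun_prop)
    refine closure_minimal (fun w hw => ?_) hcl hz
    obtain ⟨ξ, h1, h2⟩ := (LinearPMap.mem_graph_iff _).mp hw
    change ‖P.p n w.2‖ ≤ C * ‖w.1‖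
    rw [← h1, ← h2]
    exact (congrArg norm (hcomm n ξ)).symm.trans_le (hC ξ)
  refine ⟨(toPMap V).graph.topologicalClosure.toLinearPMap,
    (Submodule.toLinearPMap_graph_eq _ fun z hz h0 => ?_).symm⟩
  have hz0 : ∀ n, P.p n z.2 = 0 := fun n => by
    obtain ⟨C, hC⟩ := hle n
    simpa [h0] using hC z hz
  exact tendsto_nhds_unique (P.tendsto_p_apply z.2) (by simp [hz0])

/-- A linear map `X → H` which is closable and commutes with the compressions `pₙ D pₙ` has a
closure which is affiliated with `D'`. -/
theorem isAffiliated_closure (V : P.X →ₗ[ℂ] H) (hcl : (toPMap V).IsClosable)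
    (D : StarSubalgebra ℂ (H →L[ℂ] H))
    (hcomm : ∀ n, ∀ d ∈ D, ∀ ξ η : P.X, (η : H) = P.p n (d (P.p n ξ)) →
      V η = P.p n (d (P.p n (V ξ)))) :
    IsAffiliated (toPMap V).closure (commutant D) := by
  refine ⟨hcl.closure_isClosed, P.dense_X.mono (toPMap V).le_closure.1, ?_⟩
  let e := WithLp.prodContinuousLinearEquiv 2 ℂ H H
  let Γ := (toPMap V).graph.topologicalClosure
  have hΓ : IsClosed (Γ : Set (H × H)) := Submodule.isClosed_topologicalClosure _
  -- The closed graph is moved to the Hilbert sum, where orthogonal projections exist.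
  let G : Submodule ℂ (WithLp 2 (H × H)) := Γ.comap (e : WithLp 2 (H × H) →ₗ[ℂ] H × H)
  have hG : IsClosed (G : Set (WithLp 2 (H × H))) := hΓ.preimage e.continuous
  have hinv : ∀ d ∈ D, ∀ z ∈ G, diag d z ∈ G := by
    intro d hd z hz
    have hpre : IsClosed {w : H × H | (d w.1, d w.2) ∈ Γ} := hΓ.preimage (by fun_prop)
    refine closure_minimal (fun w hw => ?_) hpre hz
    obtain ⟨ξ, h1, h2⟩ := (LinearPMap.mem_graph_iff _).mp hw
    -- `d` need not preserve X, but its compressions pₙdpₙ do, and they converge strongly to `d`.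
    have hlim : Tendsto (fun n => (P.p n (d (P.p n w.1)), P.p n (d (P.p n w.2)))) atTop
        (𝓝 (d w.1, d w.2)) := by
      have haux : ∀ x, Tendsto (fun n => P.p n (d (P.p n x))) atTop (𝓝 (d x)) := by
        intro x
        have h3 := (d.continuous.tendsto x).comp (P.tendsto_p_apply x)
        have h4 : Tendsto (fun n => P.p n (d (P.p n x) - d x)) atTop (𝓝 0) := by
          refine squeeze_zero_norm (fun n => P.norm_p_apply_le n _) ?_
          simpa using (h3.sub_const (d x)).norm
        simpa using h4.add (P.tendsto_p_apply (d x))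
      exact (haux _).prodMk_nhds (haux _)
    refine hΓ.mem_of_tendsto hlim (Eventually.of_forall fun n => ?_)
    refine Submodule.le_topologicalClosure _ ?_
    refine (LinearPMap.mem_graph_iff _).mpr ⟨⟨_, P.p_apply_mem_X n _⟩, rfl, ?_⟩
    have := hcomm n d hd ξ ⟨P.p n (d (P.p n w.1)), P.p_apply_mem_X n _⟩ (by rw [← h1])
    rw [← h2]
    exact this
  intro u hu _ x
  have hx : ((x : H), (toPMap V).closure x) ∈ Γ := by
    rw [show Γ = (toPMap V).closure.graph from hcl.graph_closure_eq_closure_graph]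
    exact LinearPMap.mem_graph _ x
  have hux : (u (x : H), u ((toPMap V).closure x)) ∈ Γ :=
    diag_mem_of_mem_bicommutant G hG hinv hu (z := WithLp.toLp 2 (x, (toPMap V).closure x)) hx
  rw [show Γ = (toPMap V).closure.graph from hcl.graph_closure_eq_closure_graph] at hux
  obtain ⟨y, h1, h2⟩ := (LinearPMap.mem_graph_iff _).mp hux
  exact ⟨y, h1, h2⟩

end ProjectionSequence

end UnboundedStinespring

namespace UnboundedStinespring

open InnerProductSpace Filter Topology

universe u

/-! ### Feature maps of positive kernels -/

-- The reproducing kernel Hilbert space serves as `L`. Pairing with `k x` evaluates at `x`, so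
-- identities between feature vectors can be checked on kernel values.
open scoped ComplexConjugate in
theorem exists_feature_map {α : Type u} (κ : α → α → ℂ)
    (hκ : ∀ (n : ℕ) (x : Fin n → α) (c : Fin n → ℂ),
      0 ≤ ∑ k, ∑ l, conj (c k) * c l * κ (x k) (x l)) :
    ∃ (L : Type u) (_ : NormedAddCommGroup L) (_ : InnerProductSpace ℂ L) (_ : CompleteSpace L)
      (k : α → L), (∀ x y, inner ℂ (k x) (k y) = κ x y) ∧
      ∀ v w : L, (∀ x, inner ℂ (k x) v = inner ℂ (k x) w) → v = w := by
  -- Reality of the form at coefficients (1,1) and (1,i) gives the imaginary and real parts of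
  -- Hermitian symmetry.
  have hherm : ∀ x y, κ y x = conj (κ x y) := by
    intro x y
    have h0 := hκ 1 ![x] ![1]
    have h0' := hκ 1 ![y] ![1]
    have h1 := hκ 2 ![x, y] ![1, 1]
    have h2 := hκ 2 ![x, y] ![1, Complex.I]
    simp only [Fin.sum_univ_two, Complex.nonneg_iff, Fin.sum_univ_one] at h0 h0' h1 h2
    have a := h0.2
    have b := h0'.2
    have c := h1.2
    have d := h2.2
    simp at a b c d
    apply Complex.ext <;> simp <;> linarith
  let K : Matrix α α (ℂ →L[ℂ] ℂ) := .of fun x y => κ x y • ContinuousLinearMap.id ℂ ℂ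
  have hK : K.PosSemidef := by
    have h := (RKHS.posSemidef_tfae (K := K)).out 0 2
    refine h.mpr ⟨?_, fun v => ?_⟩
    · ext x y
      simp [K, Matrix.conjTranspose_apply, ContinuousLinearMap.star_eq_adjoint,
        ContinuousLinearMap.adjoint_id, hherm x y]
    · classical
      let e := v.support.equivFin.symm
      have h := (Complex.nonneg_iff.mp
        (hκ v.support.card (fun i => (e i : α)) (fun i => v (e i)))).1
      have h2 : ∑ k, ∑ l, conj (v (e k)) * v (e l) * κ (e k : α) (e l : α) =
          ∑ x ∈ v.support, ∑ y ∈ v.support, conj (v x) * v y * κ x y := by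
        rw [Equiv.sum_comp e (fun x => ∑ l, conj (v x) * v (e l) * κ (x : α) (e l : α)),
          Finset.sum_coe_sort v.support (fun x => ∑ l, conj (v x) * v (e l) * κ (x : α) (e l : α))]
        refine Finset.sum_congr rfl fun x _ => ?_
        rw [Equiv.sum_comp e (fun y => conj (v x) * v y * κ (x : α) (y : α)),
          Finset.sum_coe_sort v.support (fun y => conj (v x) * v y * κ x y)]
      rw [h2] at h
      refine h.trans_eq ?_
      change Complex.re _ = Complex.re _
      congr 1
      refine Finset.sum_congr rfl fun x _ => Finset.sum_congr rfl fun y _ => ?_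
      simp [K, hherm x y]
      ring
  have : Fact K.PosSemidef := ⟨hK⟩
  refine ⟨RKHS.OfKernel K, inferInstance, inferInstance, inferInstance,
    fun x => RKHS.kerFun (RKHS.OfKernel K) x 1, fun x y => ?_, fun v w h => ?_⟩
  · rw [← RKHS.kernel_inner, RKHS.OfKernel.kernel_ofKernel]
    simp [K, hherm x y]
  · refine RKHS.ext fun x => ?_
    simpa using h x

variable {H : Type u} [NormedAddCommGroup H] [InnerProductSpace ℂ H] [CompleteSpace H]

/-! ### Finite rank operators -/

theorem isHilbertSchmidt_rankOne (x y : H) : IsHilbertSchmidt (rankOne ℂ x y) := by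
  obtain ⟨s, b, -⟩ := exists_hilbertBasis ℂ H
  refine ⟨s, b, ?_⟩
  have := (hasSum_norm_inner_sq b y).summable.mul_right (‖x‖ ^ 2)
  simpa [norm_smul, mul_pow, norm_inner_symm y] using this

/-- The orthogonal projection onto the span of finitely many elements of a Hilbert basis. -/
noncomputable def basisProj {ι : Type*} (b : HilbertBasis ι ℂ H) (F : Finset ι) : H →L[ℂ] H :=
  ∑ i ∈ F, rankOne ℂ (b i) (b i)

theorem basisProj_apply_basis {ι : Type*} [DecidableEq ι] (b : HilbertBasis ι ℂ H) (F : Finset ι)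
    (j : ι) : basisProj b F (b j) = if j ∈ F then b j else 0 := by
  have h := orthonormal_iff_ite.mp b.orthonormal
  simp [basisProj, h]

theorem isStarProjection_basisProj {ι : Type*} (b : HilbertBasis ι ℂ H) (F : Finset ι) :
    IsStarProjection (basisProj b F) := by
  classical
  refine ⟨?_, ?_⟩
  · change basisProj b F * basisProj b F = _
    nth_rw 2 [basisProj]
    rw [Finset.mul_sum, basisProj]
    refine Finset.sum_congr rfl fun i hi => ?_
    rw [ContinuousLinearMap.mul_def, comp_rankOne, ← basisProj, basisProj_apply_basis, if_pos hi]
  · simp [IsSelfAdjoint, basisProj, star_sum, ContinuousLinearMap.star_eq_adjoint]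

/-- The operator norm is dominated by the Hilbert-Schmidt norm. -/
theorem norm_sq_le_tsum {ι : Type*} (b : HilbertBasis ι ℂ H) (T : H →L[ℂ] H) {f : ι → ℝ}
    (hf : ∀ i, ‖T (b i)‖ ^ 2 ≤ f i) (hs : Summable f) : ‖T‖ ^ 2 ≤ ∑' i, f i := by
  have h0 : 0 ≤ ∑' i, f i := tsum_nonneg fun i => (sq_nonneg _).trans (hf i)
  -- Passing to the adjoint lets Parseval apply: the coefficients of T*y are ⟨T bᵢ, y⟩.
  have hle : ‖star T‖ ≤ √(∑' i, f i) := by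
    refine ContinuousLinearMap.opNorm_le_bound _ (Real.sqrt_nonneg _) fun y => ?_
    refine abs_le_of_sq_le_sq' ?_ (by positivity) |>.2
    rw [mul_pow, Real.sq_sqrt h0]
    have h1 := hasSum_norm_inner_sq b (star T y)
    refine hasSum_le (fun i => ?_) h1 (hs.hasSum.mul_right (‖y‖ ^ 2))
    rw [ContinuousLinearMap.star_eq_adjoint, ContinuousLinearMap.adjoint_inner_right]
    calc ‖(inner ℂ (T (b i)) y : ℂ)‖ ^ 2 ≤ (‖T (b i)‖ * ‖y‖) ^ 2 := by
          gcongr; exact norm_inner_le_norm _ _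
      _ ≤ f i * ‖y‖ ^ 2 := by rw [mul_pow]; gcongr; exact hf i
  rw [norm_star] at hle
  calc ‖T‖ ^ 2 ≤ √(∑' i, f i) ^ 2 := by gcongr
    _ = _ := Real.sq_sqrt h0

/-- Hilbert-Schmidt operators are norm limits of finite rank operators. -/
theorem IsHilbertSchmidt.exists_norm_sub_mul_basisProj_lt {ι : Type*} {a : H →L[ℂ] H}
    (ha : IsHilbertSchmidt a) (b : HilbertBasis ι ℂ H) {ε : ℝ} (hε : 0 < ε) :
    ∃ F : Finset ι, ‖a - a * basisProj b F‖ < ε := by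
  classical
  have hs := ha.summable b
  have ht := tendsto_tsum_compl_atTop_zero fun i => ‖a (b i)‖ ^ 2
  -- Outside `F` the tail of ∑‖a bᵢ‖² is below ε²; on `F` the difference vanishes.
  obtain ⟨F, hF⟩ := (ht.eventually (gt_mem_nhds (sq_pos_of_pos hε))).exists
  refine ⟨F, lt_of_pow_lt_pow_left₀ 2 hε.le (lt_of_le_of_lt ?_ hF)⟩
  refine le_of_le_of_eq ?_ (tsum_subtype {i | i ∉ F} fun i => ‖a (b i)‖ ^ 2).symm
  refine norm_sq_le_tsum b _ (fun i => ?_) (hs.indicator _)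
  by_cases hi : i ∈ F <;> simp [basisProj_apply_basis, hi]

namespace ProjectionSequence

variable (P : ProjectionSequence H)

theorem memC2_rankOne {n : ℕ} {x y : H} (hx : P.p n x = x) (hy : P.p n y = y) :
    P.MemC2 n (rankOne ℂ x y) := by
  refine ⟨isHilbertSchmidt_rankOne x y, ?_⟩
  rw [ContinuousLinearMap.mul_def, ContinuousLinearMap.mul_def, comp_rankOne, rankOne_comp,
    ← ContinuousLinearMap.star_eq_adjoint, (P.isStarProjection n).isSelfAdjoint.star_eq, hx, hy]

/-- The rank one operator `z ↦ ⟨y, z⟩ x`, for `x` and `y` in `X`, as an element of `A`. -/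
noncomputable def rankOneA (x y : P.X) : P.A :=
  ⟨rankOne ℂ (x : H) (y : H), by
    obtain ⟨n, hn⟩ := P.exists_forall_p_apply_eq x.2
    obtain ⟨m, hm⟩ := P.exists_forall_p_apply_eq y.2
    exact ⟨max n m, P.memC2_rankOne (hn _ (le_max_left _ _)) (hm _ (le_max_right _ _))⟩⟩

@[simp]
theorem coe_rankOneA (x y : P.X) : (P.rankOneA x y : H →L[ℂ] H) = rankOne ℂ (x : H) (y : H) := rfl

theorem rankOneA_add_right (x y z : P.X) :
    P.rankOneA x (y + z) = P.rankOneA x y + P.rankOneA x z := by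
  ext1; simp

theorem rankOneA_smul_right (c : ℂ) (x y : P.X) :
    P.rankOneA x (c • y) = (starRingEnd ℂ) c • P.rankOneA x y := by
  ext1; simp

/-! ### The positive kernel of `Φ` and its coordinate operators -/

variable {P}

/-- `Φ(a d) = Φ(a) d` for all `a ∈ A`, wherever both sides make sense. -/
def CommutesRight (Φ : P.A →ₗ[ℂ] Module.End ℂ P.X) (d : H →L[ℂ] H) : Prop :=
  ∀ a b : P.A, (b : H →L[ℂ] H) = a * d → ∀ ξ η : P.X, (η : H) = d ξ → (Φ b ξ : H) = Φ a η

/-- Choosing n with pₙapₙ = a gives pₙΦ(a) = Φ(a), so the left factor in compatibility disappears.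
-/
theorem IsCompatible.commutesRight {Φ : P.A →ₗ[ℂ] Module.End ℂ P.X} (h : P.IsCompatible Φ)
    (m : ℕ) : CommutesRight Φ (P.p m) := by
  intro a b hb ξ η hη
  obtain ⟨n, hn⟩ := a.2
  have h1 : b = P.cut n m a := by
    ext1
    rw [hb]
    change _ = P.p n * (a : H →L[ℂ] H) * P.p m
    rw [hn.left le_rfl]
  have h2 : a = P.cut n n a := Subtype.ext hn.2.symm
  have h3 : η = P.pX m ξ := Subtype.ext hη
  have h4 : ∀ ζ, P.pX n (Φ a ζ) = Φ a ζ := fun ζ => by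
    rw [h2, h n n a]
    ext1
    exact congrArg (fun T : H →L[ℂ] H => T _) (P.isStarProjection n).isIdempotentElem
  rw [h1, h n m a, h3]
  exact congrArg Subtype.val (h4 _)

theorem IsBimodular.commutesRight {Φ : P.A →ₗ[ℂ] Module.End ℂ P.X}
    {D : StarSubalgebra ℂ (H →L[ℂ] H)} (h : P.IsBimodular D Φ) {d : H →L[ℂ] H} (hd : d ∈ D) :
    CommutesRight Φ d := fun a b hb ξ η hη => by
  simpa using h 1 (one_mem D) d hd a b (by simpa using hb) ξ η hη

/-- The kernel on `X × X` defined by `Φ`. -/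
noncomputable def kernel (Φ : P.A →ₗ[ℂ] Module.End ℂ P.X) (z w : P.X × P.X) : ℂ :=
  inner ℂ (z.2 : H) (Φ (P.rankOneA z.1 w.1) w.2 : H)

theorem IsCompletelyPositive.kernel_nonneg {Φ : P.A →ₗ[ℂ] Module.End ℂ P.X}
    (hpos : P.IsCompletelyPositive Φ) (n : ℕ) (z : Fin n → P.X × P.X) (c : Fin n → ℂ) :
    0 ≤ ∑ k, ∑ l, (starRingEnd ℂ) (c k) * c l * kernel Φ (z k) (z l) := by
  -- A unit vector for the factorization x⊗y = (e⊗x)*(e⊗y) exists only when X is nonzero.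
  rcases subsingleton_or_nontrivial P.X with hX | hX
  · have : ∀ w w', kernel Φ w w' = 0 := fun w w' => by
      rw [kernel, Subsingleton.elim w.2 0]; simp
    simp [this]
  · obtain ⟨e₀, he₀⟩ := exists_ne (0 : P.X)
    obtain ⟨e, he⟩ : ∃ e : P.X, ‖e‖ = 1 := ⟨_, norm_smul_inv_norm (𝕜 := ℂ) he₀⟩
    refine (hpos n (fun k => P.rankOneA e (z k).1) (fun k => c k • (z k).2)).trans_eq ?_
    refine Finset.sum_congr rfl fun k _ => Finset.sum_congr rfl fun l _ => ?_
    have h1 : star (P.rankOneA e (z k).1) * P.rankOneA e (z l).1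
        = P.rankOneA (z k).1 (z l).1 := by
      ext1
      have he' : ‖(e : H)‖ = 1 := he
      simp [ContinuousLinearMap.star_eq_adjoint, ContinuousLinearMap.mul_def, comp_rankOne,
        inner_self_eq_norm_sq_to_K, he']
    rw [h1, kernel, map_smul]
    simp
    ring

/-- This controls the squared norm of a feature vector, as needed for Riesz representation; it uses
‖x⊗x‖ = ‖x‖². -/
theorem kernel_self_le {Φ : P.A →ₗ[ℂ] Module.End ℂ P.X} {n : ℕ} {C : ℝ}
    (hC : ∀ a : P.A, P.MemC2 n a → ∀ ξ : P.X,
      ‖(Φ a ξ : H)‖ ≤ C * ‖(a : H →L[ℂ] H)‖ * ‖(ξ : H)‖) {x : P.X} (hx : P.p n x = x) (ξ : P.X) :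
    ‖kernel Φ (x, ξ) (x, ξ)‖ ≤ C * (‖(x : H)‖ * ‖(ξ : H)‖) ^ 2 := by
  refine (norm_inner_le_norm _ _).trans ?_
  have := hC (P.rankOneA x x) (P.memC2_rankOne hx hx) ξ
  rw [coe_rankOneA, norm_rankOne] at this
  calc ‖(ξ : H)‖ * ‖(Φ (P.rankOneA x x) ξ : H)‖
      ≤ ‖(ξ : H)‖ * (C * (‖(x : H)‖ * ‖(x : H)‖) * ‖(ξ : H)‖) := by gcongr
    _ = _ := by ring

/-- The coordinates of the feature map of `kernel Φ` define operators `V j`. -/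
theorem exists_kraus_family {Φ : P.A →ₗ[ℂ] Module.End ℂ P.X} (hpos : P.IsCompletelyPositive Φ)
    (hcompat : P.IsCompatible Φ) (hbdd : P.IsLocallyBounded Φ) :
    ∃ (ι : Type u) (V : ι → P.X →ₗ[ℂ] H),
      (∀ x y ξ η : P.X, HasSum (fun j => inner ℂ (V j η) (x : H) * inner ℂ (y : H) (V j ξ))
        (inner ℂ (η : H) (Φ (P.rankOneA x y) ξ : H))) ∧
      ∀ d : H →L[ℂ] H, CommutesRight Φ d → (∀ x : P.X, star d x ∈ P.X) →
        ∀ j, ∀ ξ η : P.X, (η : H) = d ξ → V j η = d (V j ξ) := by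
  obtain ⟨L, _, _, _, k, hk, hext⟩ := exists_feature_map (kernel Φ) hpos.kernel_nonneg
  obtain ⟨s, f, -⟩ := exists_hilbertBasis ℂ L
  have hadd : ∀ x ξ ξ', k (x, ξ + ξ') = k (x, ξ) + k (x, ξ') := fun x ξ ξ' =>
    hext _ _ fun z => by simp [hk, kernel]
  have hsmul : ∀ x (c : ℂ) ξ, k (x, c • ξ) = c • k (x, ξ) := fun x c ξ =>
    hext _ _ fun z => by simp [hk, kernel]
  have hadd' : ∀ x x' ξ, k (x + x', ξ) = k (x, ξ) + k (x', ξ) := fun x x' ξ =>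
    hext _ _ fun z => by simp [hk, kernel, rankOneA_add_right]
  have hsmul' : ∀ (c : ℂ) x ξ, k (c • x, ξ) = (starRingEnd ℂ) c • k (x, ξ) := fun c x ξ =>
    hext _ _ fun z => by simp [hk, kernel, rankOneA_smul_right]
  -- Since (z⊗x)d = z⊗(d*x), right modularity moves `d` between the two entries of `k`.
  have hstar : ∀ d : H →L[ℂ] H, CommutesRight Φ d → ∀ x x' ξ ξ' : P.X, (x' : H) = star d x →
      (ξ' : H) = d ξ → k (x', ξ) = k (x, ξ') := fun d hd x x' ξ ξ' hx hξ =>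
    hext _ _ fun z => by
      rw [hk, hk, kernel, kernel, hd (P.rankOneA z.1 x) (P.rankOneA z.1 x') ?_ ξ ξ' hξ]
      rw [coe_rankOneA, coe_rankOneA, ContinuousLinearMap.mul_def, rankOne_comp, hx]
      rfl
  have hex : ∀ j ξ, ∃ v : H, ∀ x : P.X, inner ℂ (x : H) v = inner ℂ (f j) (k (x, ξ)) := by
    intro j ξ
    obtain ⟨n, hn⟩ := P.exists_forall_p_apply_eq ξ.2
    obtain ⟨C, hC⟩ := hbdd n
    let q : H →ₗ[ℂ] P.X := (P.p n : H →ₗ[ℂ] H).codRestrict P.X (P.p_apply_mem_X n)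
    have hq : ∀ x, P.p n (q x) = q x := fun x => P.mem_range_iff.mp ⟨x, rfl⟩
    -- As pₙ fixes `ξ`, only the part of `x` in Hₙ matters, so one local constant bounds the
    -- functional on all of `H`.
    have hqk : ∀ x : P.X, k (q x, ξ) = k (x, ξ) := fun x =>
      hstar (P.p n) (hcompat.commutesRight n) x (q x) ξ ξ
        (by rw [(P.isStarProjection n).isSelfAdjoint.star_eq]; rfl) (hn n le_rfl).symm
    -- The coordinate is conjugated to make it linear in `x`.
    let ℓ₀ : H →ₗ[ℂ] ℂ :=
      { toFun := fun x => inner ℂ (k (q x, ξ)) (f j)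
        map_add' := fun x y => by rw [map_add, hadd', inner_add_left]
        map_smul' := fun c x => by
          rw [map_smul, hsmul', inner_smul_left, RingHomCompTriple.comp_apply]; rfl }
    have hb : ∀ x, ‖ℓ₀ x‖ ≤ (√|C| * ‖(ξ : H)‖ * ‖f j‖) * ‖x‖ := by
      intro x
      have h1 : ‖k (q x, ξ)‖ ≤ √|C| * ‖(ξ : H)‖ * ‖x‖ := by
        refine abs_le_of_sq_le_sq' ?_ (by positivity) |>.2
        have h2 := kernel_self_le hC (hq x) ξ
        rw [← hk, inner_self_eq_norm_sq_to_K] at h2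
        have h3 : ‖(q x : H)‖ ≤ ‖x‖ := P.norm_p_apply_le n x
        calc ‖k (q x, ξ)‖ ^ 2 ≤ C * (‖(q x : H)‖ * ‖(ξ : H)‖) ^ 2 := by simpa using h2
          _ ≤ |C| * (‖x‖ * ‖(ξ : H)‖) ^ 2 := by gcongr; exact le_abs_self C
          _ = (√|C| * ‖(ξ : H)‖ * ‖x‖) ^ 2 := by
            rw [mul_pow, mul_pow, mul_pow, Real.sq_sqrt (abs_nonneg C)]; ring
      calc ‖ℓ₀ x‖ ≤ ‖k (q x, ξ)‖ * ‖f j‖ := norm_inner_le_norm _ _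
        _ ≤ (√|C| * ‖(ξ : H)‖ * ‖x‖) * ‖f j‖ := by gcongr
        _ = _ := by ring
    refine ⟨(toDual ℂ H).symm (ℓ₀.mkContinuous _ hb), fun x => ?_⟩
    rw [← inner_conj_symm, toDual_symm_apply, ← inner_conj_symm (f j), ← hqk]
    rfl
  choose v hv using hex
  have huniq : ∀ w w' : H, (∀ x : P.X, inner ℂ (x : H) w = inner ℂ (x : H) w') → w = w' :=
    fun w w' h => P.dense_X.eq_of_inner_right ℂ fun x hx => h ⟨x, hx⟩
  let V : s → P.X →ₗ[ℂ] H := fun j =>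
    { toFun := v j
      map_add' := fun ξ ξ' => huniq _ _ fun x => by
        rw [inner_add_right, hv, hv, hv, hadd, inner_add_right]
      map_smul' := fun c ξ => huniq _ _ fun x => by
        rw [RingHom.id_apply, inner_smul_right, hv, hv, hsmul, inner_smul_right] }
  have hV : ∀ j ξ (x : P.X), inner ℂ (x : H) (V j ξ) = inner ℂ (f j) (k (x, ξ)) := hv
  refine ⟨s, V, fun x y ξ η => ?_, fun d hd hd' j ξ η hη => ?_⟩
  · have h := f.hasSum_inner_mul_inner (k (x, η)) (k (y, ξ))
    rw [hk] at h
    have h1 : ∀ j, inner ℂ (V j η) (x : H) = inner ℂ (k (x, η)) (f j) := fun j => by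
      rw [← inner_conj_symm, hV, inner_conj_symm]
    simp only [h1, hV]
    exact h
  · refine huniq _ _ fun x => ?_
    rw [hV, ← ContinuousLinearMap.adjoint_inner_left, ← ContinuousLinearMap.star_eq_adjoint,
      hV j ξ ⟨star d x, hd' x⟩, hstar d hd x ⟨star d x, hd' x⟩ ξ η rfl hη]

end ProjectionSequence

end UnboundedStinespring

namespace UnboundedStinespring

open InnerProductSpace Filter Topology

universe u

variable {H : Type u} [NormedAddCommGroup H] [InnerProductSpace ℂ H] [CompleteSpace H]

/-! ### Square summability, extension to `A`, and countability -/

namespace ProjectionSequence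

variable {P : ProjectionSequence H}

variable (P) in
/-- The finite rank operator `pₙ a q pₙ` of `A`, where `q` is the projection onto the span of
finitely many basis vectors. -/
noncomputable def finiteRankA {ι : Type*} (n : ℕ) (a : H →L[ℂ] H) (b : HilbertBasis ι ℂ H)
    (F : Finset ι) : P.A :=
  ∑ i ∈ F, P.rankOneA ⟨P.p n (a (b i)), P.p_apply_mem_X n _⟩ ⟨P.p n (b i), P.p_apply_mem_X n _⟩

theorem coe_finiteRankA {ι : Type*} (n : ℕ) (a : H →L[ℂ] H) (b : HilbertBasis ι ℂ H)
    (F : Finset ι) :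
    (P.finiteRankA n a b F : H →L[ℂ] H) = P.p n * (a * basisProj b F) * P.p n := by
  rw [finiteRankA, AddSubmonoidClass.coe_finsetSum, basisProj, Finset.mul_sum, Finset.mul_sum,
    Finset.sum_mul]
  refine Finset.sum_congr rfl fun i _ => ?_
  rw [coe_rankOneA, ContinuousLinearMap.mul_def, ContinuousLinearMap.mul_def,
    ContinuousLinearMap.mul_def, comp_rankOne, comp_rankOne, rankOne_comp,
    ← ContinuousLinearMap.star_eq_adjoint, (P.isStarProjection n).isSelfAdjoint.star_eq]

theorem memC2_finiteRankA {ι : Type*} (n : ℕ) (a : H →L[ℂ] H) (b : HilbertBasis ι ℂ H)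
    (F : Finset ι) : P.MemC2 n (P.finiteRankA n a b F) := by
  obtain ⟨m, hm⟩ := (P.finiteRankA n a b F).2
  refine ⟨hm.1, ?_⟩
  have h : P.p n * P.p n = P.p n := (P.isStarProjection n).isIdempotentElem
  rw [coe_finiteRankA, mul_assoc, mul_assoc _ (P.p n), h, ← mul_assoc, ← mul_assoc, h]

theorem norm_finiteRankA_one_le {ι : Type*} (n : ℕ) (b : HilbertBasis ι ℂ H) (F : Finset ι) :
    ‖(P.finiteRankA n 1 b F : H →L[ℂ] H)‖ ≤ 1 := by
  rw [coe_finiteRankA, one_mul]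
  refine (norm_mul_le _ _).trans (mul_le_one₀ ((norm_mul_le _ _).trans
    (mul_le_one₀ (P.norm_p_le n) (norm_nonneg _) (isStarProjection_basisProj b F).norm_le))
    (norm_nonneg _) (P.norm_p_le n))

/-- The family `V` represents `Φ` on rank one operators. -/
def RepresentsRankOne {ι : Type*} (V : ι → P.X →ₗ[ℂ] H) (Φ : P.A →ₗ[ℂ] Module.End ℂ P.X) :
    Prop :=
  ∀ x y ξ η : P.X, HasSum (fun j => inner ℂ (V j η) (x : H) * inner ℂ (y : H) (V j ξ))
    (inner ℂ (η : H) (Φ (P.rankOneA x y) ξ : H))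

section Family

variable {ι : Type*} {V : ι → P.X →ₗ[ℂ] H} {Φ : P.A →ₗ[ℂ] Module.End ℂ P.X}

theorem RepresentsRankOne.hasSum_finiteRankA (hV : RepresentsRankOne V Φ)
    {κ : Type*} (n : ℕ) (a : H →L[ℂ] H)
    (b : HilbertBasis κ ℂ H) (F : Finset κ) (ξ η : P.X) :
    HasSum (fun j => inner ℂ (V j η) ((P.finiteRankA n a b F : H →L[ℂ] H) (V j ξ)))
      (inner ℂ (η : H) (Φ (P.finiteRankA n a b F) ξ : H)) := by
  have h := hasSum_sum (s := F) fun i _ =>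
    hV ⟨P.p n (a (b i)), P.p_apply_mem_X n _⟩ ⟨P.p n (b i), P.p_apply_mem_X n _⟩ ξ η
  convert h using 1
  · funext j
    simp [finiteRankA, mul_comm]
  · simp [finiteRankA]

/-- Apply the representation to pₙq_Fpₙ, with q_F a finite basis projection. Its operator norm is at
most 1 for every `F`, so the bound is uniform in `F` and Parseval recovers ‖V_j ξ‖²; a
Hilbert–Schmidt bound would grow with `F`. -/
theorem RepresentsRankOne.sum_norm_sq_le (hV : RepresentsRankOne V Φ)
    (hp : ∀ n j ξ, V j (P.pX n ξ) = P.p n (V j ξ)) {n : ℕ} {C : ℝ}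
    (hC : ∀ a : P.A, P.MemC2 n a → ∀ ξ : P.X,
      ‖(Φ a ξ : H)‖ ≤ C * ‖(a : H →L[ℂ] H)‖ * ‖(ξ : H)‖) {ξ : P.X} (hξ : P.p n ξ = ξ)
    (J : Finset ι) : ∑ j ∈ J, ‖V j ξ‖ ^ 2 ≤ |C| * ‖(ξ : H)‖ ^ 2 := by
  obtain ⟨s, b, -⟩ := exists_hilbertBasis ℂ H
  have hpV : ∀ j, P.p n (V j ξ) = V j ξ := fun j => by
    rw [← hp]; exact congrArg (V j) (Subtype.ext hξ)
  refine hasSum_le_of_sum_le (hasSum_sum fun j _ => hasSum_norm_inner_sq b (V j ξ)) fun F => ?_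
  have hs := (hV.hasSum_finiteRankA n 1 b F ξ ξ).mapL Complex.reCLM
  have hterm : ∀ j, Complex.reCLM (inner ℂ (V j ξ)
      ((P.finiteRankA n 1 b F : H →L[ℂ] H) (V j ξ))) = ∑ i ∈ F, ‖inner ℂ (b i) (V j ξ)‖ ^ 2 := by
    intro j
    rw [coe_finiteRankA, one_mul, mul_apply_eq_comp, mul_apply_eq_comp,
      ← P.inner_p_left, hpV, basisProj]
    simp only [sum_apply, rankOne_apply, inner_sum, inner_smul_right, map_sum]
    refine Finset.sum_congr rfl fun i _ => ?_
    rw [← inner_conj_symm (V j ξ), Complex.mul_conj, Complex.normSq_eq_norm_sq]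
    exact Complex.ofReal_re _
  simp only [hterm] at hs
  rw [Finset.sum_comm]
  calc ∑ j ∈ J, ∑ i ∈ F, ‖inner ℂ (b i) (V j ξ)‖ ^ 2
      ≤ Complex.reCLM (inner ℂ (ξ : H) (Φ (P.finiteRankA n 1 b F) ξ : H)) :=
        sum_le_hasSum J (fun j _ => Finset.sum_nonneg fun i _ => sq_nonneg _) hs
    _ ≤ ‖(inner ℂ (ξ : H) (Φ (P.finiteRankA n 1 b F) ξ : H) : ℂ)‖ := Complex.re_le_norm _
    _ ≤ ‖(ξ : H)‖ * ‖(Φ (P.finiteRankA n 1 b F) ξ : H)‖ := norm_inner_le_norm _ _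
    _ ≤ ‖(ξ : H)‖ * (|C| * 1 * ‖(ξ : H)‖) := by
        gcongr
        refine (hC _ (memC2_finiteRankA n 1 b F) ξ).trans ?_
        gcongr
        · exact le_abs_self C
        · exact norm_finiteRankA_one_le n b F
    _ = |C| * ‖(ξ : H)‖ ^ 2 := by ring

theorem RepresentsRankOne.summable_norm_sq (hV : RepresentsRankOne V Φ)
    (hp : ∀ n j ξ, V j (P.pX n ξ) = P.p n (V j ξ)) (hbdd : P.IsLocallyBounded Φ) (ξ : P.X) :
    Summable fun j => ‖V j ξ‖ ^ 2 := by
  obtain ⟨n, hn⟩ := P.exists_forall_p_apply_eq ξ.2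
  obtain ⟨C, hC⟩ := hbdd n
  exact summable_of_sum_le (fun _ => sq_nonneg _) (hV.sum_norm_sq_le hp hC (hn n le_rfl))

theorem RepresentsRankOne.exists_norm_le (hV : RepresentsRankOne V Φ)
    (hp : ∀ n j ξ, V j (P.pX n ξ) = P.p n (V j ξ)) (hbdd : P.IsLocallyBounded Φ) (n : ℕ) :
    ∃ C : ℝ, 0 ≤ C ∧ ∀ j ξ, ‖V j (P.pX n ξ)‖ ≤ C * ‖(ξ : H)‖ := by
  obtain ⟨C, hC⟩ := hbdd n
  refine ⟨√|C|, Real.sqrt_nonneg _, fun j ξ => abs_le_of_sq_le_sq' ?_ (by positivity) |>.2⟩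
  have h := hV.sum_norm_sq_le hp hC (ξ := P.pX n ξ) (P.mem_range_iff.mp ⟨ξ, rfl⟩) {j}
  rw [Finset.sum_singleton] at h
  rw [mul_pow, Real.sq_sqrt (abs_nonneg C)]
  refine h.trans ?_
  gcongr
  exact P.norm_p_apply_le n ξ

/-- The representation extends from finite rank operators to all of `A`. -/
theorem RepresentsRankOne.hasSum (hV : RepresentsRankOne V Φ)
    (hp : ∀ n j ξ, V j (P.pX n ξ) = P.p n (V j ξ)) (hbdd : P.IsLocallyBounded Φ)
    (a : P.A) (ξ η : P.X) :
    HasSum (fun j => inner ℂ (V j η) ((a : H →L[ℂ] H) (V j ξ)))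
      (inner ℂ (η : H) (Φ a ξ : H)) := by
  obtain ⟨s, b, -⟩ := exists_hilbertBasis ℂ H
  have hsum := (hV.summable_norm_sq hp hbdd η).add (hV.summable_norm_sq hp hbdd ξ)
  have hle : ∀ (c : H →L[ℂ] H) j, ‖(inner ℂ (V j η) (c (V j ξ)) : ℂ)‖ ≤
      ‖c‖ * (‖V j η‖ ^ 2 + ‖V j ξ‖ ^ 2) := by
    intro c j
    calc ‖(inner ℂ (V j η) (c (V j ξ)) : ℂ)‖ ≤ ‖V j η‖ * (‖c‖ * ‖V j ξ‖) :=
          (norm_inner_le_norm _ _).trans (by gcongr; exact c.le_opNorm _)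
      _ = ‖c‖ * (‖V j η‖ * ‖V j ξ‖) := by ring
      _ ≤ _ := by
        gcongr
        nlinarith [sq_nonneg (‖V j η‖ - ‖V j ξ‖), sq_nonneg ‖V j η‖, sq_nonneg ‖V j ξ‖]
  have hsm : ∀ c : H →L[ℂ] H, Summable fun j => (inner ℂ (V j η) (c (V j ξ)) : ℂ) := fun c =>
    Summable.of_norm_bounded (hsum.mul_left ‖c‖) (hle c)
  obtain ⟨n, hn⟩ := a.2
  obtain ⟨C, hC⟩ := hbdd n
  set M := ∑' j, (‖V j η‖ ^ 2 + ‖V j ξ‖ ^ 2)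
  have hM : 0 ≤ M := tsum_nonneg fun j => by positivity
  set g : (H →L[ℂ] H) → ℂ := fun c => ∑' j, inner ℂ (V j η) (c (V j ξ)) with hg
  have hgM : ∀ c, ‖g c‖ ≤ ‖c‖ * M := fun c =>
    tsum_of_norm_bounded (hsum.hasSum.mul_left ‖c‖) (hle c)
  set K := M + |C| * ‖(ξ : H)‖ * ‖(η : H)‖
  have hK : 0 ≤ K := by positivity
  -- `M` bounds the series and |C|‖ξ‖‖η‖ bounds the Φ side, per unit of operator norm; the two sides
  -- agree on the finite rank approximant.
  have happrox : ∀ ε > 0, ‖g a - inner ℂ (η : H) (Φ a ξ : H)‖ ≤ ε * K := by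
    intro ε hε
    obtain ⟨F, hF⟩ := hn.1.exists_norm_sub_mul_basisProj_lt b hε
    set a' := P.finiteRankA n a b F with ha'
    have hdiff : ‖((a - a' : P.A) : H →L[ℂ] H)‖ ≤ ε := by
      have h1 : ((a - a' : P.A) : H →L[ℂ] H) = P.p n * (a - a * basisProj b F) * P.p n := by
        rw [mul_sub, sub_mul, hn.2, ← coe_finiteRankA]; rfl
      rw [h1]
      calc _ ≤ 1 * ‖(a : H →L[ℂ] H) - a * basisProj b F‖ * 1 := by
            refine (norm_mul_le _ _).trans ?_
            gcongr
            · refine (norm_mul_le _ _).trans ?_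
              gcongr
              exact P.norm_p_le n
            · exact P.norm_p_le n
        _ ≤ ε := by rw [one_mul, mul_one]; exact hF.le
    have hmem : P.MemC2 n ((a - a' : P.A) : H →L[ℂ] H) := by
      have h2 := memC2_finiteRankA (P := P) n a b F
      obtain ⟨m, hm⟩ := (a - a').2
      refine ⟨hm.1, ?_⟩
      change P.p n * ((a : H →L[ℂ] H) - a') * P.p n = a - a'
      rw [mul_sub, sub_mul, hn.2, h2.2]
    have h3 : g a' = inner ℂ (η : H) (Φ a' ξ : H) := (hV.hasSum_finiteRankA n a b F ξ η).tsum_eq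
    have h4 : g a - g a' = g ((a - a' : P.A) : H →L[ℂ] H) := by
      simp only [hg]
      rw [← (hsm a).tsum_sub (hsm a')]
      refine tsum_congr fun j => ?_
      rw [← inner_sub_right]
      rfl
    have h5 : inner ℂ (η : H) (Φ a ξ : H) - inner ℂ (η : H) (Φ a' ξ : H) =
        inner ℂ (η : H) (Φ (a - a') ξ : H) := by
      simp
    have h6 : g a - inner ℂ (η : H) (Φ a ξ : H) =
        g ((a - a' : P.A) : H →L[ℂ] H) - inner ℂ (η : H) (Φ (a - a') ξ : H) := by
      rw [← h4, ← h5, h3]; ring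
    rw [h6]
    have h7 : ‖(inner ℂ (η : H) (Φ (a - a') ξ : H) : ℂ)‖ ≤
        ‖(η : H)‖ * (|C| * ε * ‖(ξ : H)‖) := by
      refine (norm_inner_le_norm _ _).trans ?_
      gcongr
      refine (hC _ hmem ξ).trans ?_
      gcongr
      exact le_abs_self C
    calc _ ≤ ε * M + ‖(η : H)‖ * (|C| * ε * ‖(ξ : H)‖) :=
          (norm_sub_le _ _).trans (add_le_add ((hgM _).trans (by gcongr)) h7)
      _ = ε * K := by ring
  have hlim : g a = inner ℂ (η : H) (Φ a ξ : H) := by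
    refine eq_of_sub_eq_zero (norm_le_zero_iff.mp (le_of_forall_pos_le_add fun ε hε => ?_))
    -- K + 1 avoids division by zero when `K` vanishes.
    refine (happrox (ε / (K + 1)) (by positivity)).trans ?_
    rw [zero_add, div_mul_eq_mul_div, div_le_iff₀ (by positivity)]
    nlinarith
  rw [← hlim]
  exact (hsm a).hasSum

/-- In a separable space only countably many members of the family do not vanish. -/
theorem RepresentsRankOne.countable_ne_zero [TopologicalSpace.SeparableSpace H]
    (hV : RepresentsRankOne V Φ) (hp : ∀ n j ξ, V j (P.pX n ξ) = P.p n (V j ξ))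
    (hbdd : P.IsLocallyBounded Φ) : {j | V j ≠ 0}.Countable := by
  let y := TopologicalSpace.denseSeq H
  let q : ℕ → H →ₗ[ℂ] P.X := fun n =>
    (P.p n : H →ₗ[ℂ] H).codRestrict P.X (P.p_apply_mem_X n)
  -- Square summability at each of the countably many vectors pₙyₘ leaves countably many indices;
  -- any other V_j vanishes by density, since V_j ∘ pₙ is bounded.
  have hc : (⋃ n, ⋃ m, {j | V j (q n (y m)) ≠ 0}).Countable := by
    refine Set.countable_iUnion fun n => Set.countable_iUnion fun m => ?_
    refine (hV.summable_norm_sq hp hbdd (q n (y m))).countable_support.mono fun j hj => ?_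
    simpa using hj
  refine hc.mono fun j hj => ?_
  by_contra hj'
  simp only [Set.mem_iUnion, Set.mem_ofPred_eq, not_exists, not_not] at hj'
  refine hj (LinearMap.ext fun ξ => ?_)
  obtain ⟨n, hn⟩ := P.exists_forall_p_apply_eq ξ.2
  obtain ⟨C, -, hC⟩ := hV.exists_norm_le hp hbdd n
  have hqq : ∀ x, P.pX n (q n x) = q n x := fun x =>
    Subtype.ext (P.mem_range_iff.mp ⟨x, rfl⟩)
  let T : H →L[ℂ] H := ((V j).comp (q n)).mkContinuous |C| fun x => by
    have := hC j (q n x)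
    rw [hqq] at this
    refine this.trans ?_
    gcongr
    · exact le_abs_self C
    · exact P.norm_p_apply_le n x
  have hT : (T : H → H) = 0 := T.continuous.ext_on (TopologicalSpace.denseRange_denseSeq H)
    continuous_const (by rintro _ ⟨m, rfl⟩; exact hj' n m)
  have hξ : q n ξ = ξ := Subtype.ext (hn n le_rfl)
  rw [← hξ]
  exact congrFun hT ξ

end Family

/-! ### Reindexing by `ℕ` and the bimodule case -/

/-- The representation indexed by `ℕ`, by operators which commute with every `d` which commutes
with `Φ` on the right. -/
theorem exists_kraus_sequence [TopologicalSpace.SeparableSpace H]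
    {Φ : P.A →ₗ[ℂ] Module.End ℂ P.X} (hpos : P.IsCompletelyPositive Φ)
    (hcompat : P.IsCompatible Φ) (hbdd : P.IsLocallyBounded Φ) :
    ∃ V : ℕ → P.X →ₗ[ℂ] H,
      (∀ i, (toPMap (V i)).IsClosable) ∧
      (∀ d : H →L[ℂ] H, CommutesRight Φ d → (∀ x : P.X, star d x ∈ P.X) →
        ∀ i, ∀ ξ η : P.X, (η : H) = d ξ → V i η = d (V i ξ)) ∧
      ∀ (a : P.A) (ξ η : P.X), HasSum (fun i => inner ℂ (V i η) ((a : H →L[ℂ] H) (V i ξ)))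
        (inner ℂ (η : H) (Φ a ξ : H)) := by
  obtain ⟨ι, V, hV, hcomm⟩ := exists_kraus_family hpos hcompat hbdd
  replace hV : RepresentsRankOne V Φ := hV
  have hp : ∀ n j ξ, V j (P.pX n ξ) = P.p n (V j ξ) := fun n j ξ =>
    hcomm (P.p n) (hcompat.commutesRight n)
      (fun x => by
        rw [(P.isStarProjection n).isSelfAdjoint.star_eq]; exact P.p_apply_mem_X n x) j ξ _ rfl
  have hcount := hV.countable_ne_zero hp hbdd
  have : Countable {j | V j ≠ 0} := hcount
  obtain ⟨e, he⟩ := exists_injective_nat {j | V j ≠ 0}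
  -- Unused indices carry the zero operator, which leaves the sum and the commutation relations
  -- intact.
  let W : ℕ → P.X →ₗ[ℂ] H := Function.extend e (fun j => V j) 0
  have hW : ∀ i, (∃ j, W i = V j) ∨ W i = 0 := fun i => by
    by_cases hi : ∃ j, e j = i
    · obtain ⟨j, rfl⟩ := hi
      exact Or.inl ⟨j, he.extend_apply _ _ j⟩
    · exact Or.inr (Function.extend_apply' _ _ _ hi)
  have hWcomm : ∀ d : H →L[ℂ] H, CommutesRight Φ d → (∀ x : P.X, star d x ∈ P.X) →
      ∀ i, ∀ ξ η : P.X, (η : H) = d ξ → W i η = d (W i ξ) := by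
    intro d hd hd' i ξ η h
    rcases hW i with ⟨j, hj⟩ | hj
    · rw [hj, hcomm d hd hd' j ξ η h]
    · simp [hj]
  refine ⟨W, fun i => ?_, hWcomm, fun a ξ η => ?_⟩
  · refine P.isClosable_toPMap (W i) (fun n ξ => ?_) fun n => ?_
    · rcases hW i with ⟨j, hj⟩ | hj
      · rw [hj, hp]
      · simp [hj]
    · obtain ⟨C, hC0, hC⟩ := hV.exists_norm_le hp hbdd n
      refine ⟨C, fun ξ => ?_⟩
      rcases hW i with ⟨j, hj⟩ | hj
      · rw [hj]; exact hC j ξ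
      · simpa [hj] using mul_nonneg hC0 (norm_nonneg _)
  · have h := hV.hasSum hp hbdd a ξ η
    rw [← hasSum_subtype_iff_of_support_subset (s := {j | V j ≠ 0}) fun j hj h0 => hj (by simp [h0])]
      at h
    refine (he.hasSum_iff fun i hi => ?_).mp ?_
    · have : W i = 0 := Function.extend_apply' _ _ _ hi
      simp [this]
    · have hWe : ∀ j, W (e j) = V j := fun j => he.extend_apply _ _ j
      convert h using 1
      funext j
      simp only [Function.comp_apply, hWe]

theorem IsBimodular.commutesRight_compression {Φ : P.A →ₗ[ℂ] Module.End ℂ P.X}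
    {D : StarSubalgebra ℂ (H →L[ℂ] H)} (h : P.IsBimodular D Φ) (hD : ∀ n, P.p n ∈ D)
    {d : H →L[ℂ] H} (hd : d ∈ D) (n : ℕ) : CommutesRight Φ (P.p n * d * P.p n) :=
  h.commutesRight (mul_mem (mul_mem (hD n) hd) (hD n))

end ProjectionSequence

end UnboundedStinespring

theorem theorem2p2 {H : Type*} [NormedAddCommGroup H] [InnerProductSpace ℂ H] [CompleteSpace H]
    [TopologicalSpace.SeparableSpace H]
    (P : UnboundedStinespring.ProjectionSequence H)
    (Φ : P.A →ₗ[ℂ] Module.End ℂ P.X)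
    (hpos : P.IsCompletelyPositive Φ)
    (hcompat : P.IsCompatible Φ)
    (hbdd : P.IsLocallyBounded Φ) :
    (∃ V : ℕ → P.X →ₗ[ℂ] H,
      (∀ i, (UnboundedStinespring.toPMap (V i)).IsClosable) ∧
      ∀ (a : P.A) (ξ η : P.X),
        HasSum (fun i => inner ℂ (V i η) ((a : H →L[ℂ] H) (V i ξ)))
          (inner ℂ (η : H) (Φ a ξ : H))) ∧
    ∀ D : StarSubalgebra ℂ (H →L[ℂ] H), IsClosed (D : Set (H →L[ℂ] H)) →
      (∀ n, P.p n ∈ D) → P.IsBimodular D Φ →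
      ∃ V : ℕ → P.X →ₗ[ℂ] H,
        (∀ i, (UnboundedStinespring.toPMap (V i)).IsClosable ∧
          UnboundedStinespring.IsAffiliated (UnboundedStinespring.toPMap (V i)).closure
            (UnboundedStinespring.commutant D)) ∧
        ∀ (a : P.A) (ξ η : P.X),
          HasSum (fun i => inner ℂ (V i η) ((a : H →L[ℂ] H) (V i ξ)))
            (inner ℂ (η : H) (Φ a ξ : H)) := by
  obtain ⟨V, hcl, hcomm, hsum⟩ :=
    UnboundedStinespring.ProjectionSequence.exists_kraus_sequence hpos hcompat hbdd
  -- One sequence serves both parts: it already commutes with everything that `Φ` respects on the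
  -- right and whose adjoint preserves X.
  refine ⟨⟨V, hcl, hsum⟩, fun D _ hD hbim => ⟨V, fun i => ⟨hcl i, ?_⟩, hsum⟩⟩
  refine P.isAffiliated_closure (V i) (hcl i) D fun n d hd ξ η hη => ?_
  refine hcomm (P.p n * d * P.p n) (hbim.commutesRight_compression hD hd n) (fun x => ?_) i ξ η hη
  rw [star_mul, (P.isStarProjection n).isSelfAdjoint.star_eq]
  exact P.p_apply_mem_X n _
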